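/- A \emph{restriction monoid} is an algebra $(S;\cdot,{}^*,{}^+,1)$ such that $(S;\cdot,1)$ is a monoid and $$xx^*=x,\quad x^*y^*=y^*x^*,\quad (xy^*)^*=x^*y^*,\quad x^*y=y(xy)^*,$$ $$x^+x=x,\quad x^+y^+=y^+x^+,\quad (x^+y)^+=x^+y^+,\quad xy^+=(xy)^+x,$$ $$(x^+)^*=x^+,\quad (x^*)^+=x^*$$ hold identically; homomorphisms preserve all four operations. Every inverse monoid is a restriction monoid with $x^*=x^{-1}x$ and $x^+=xx^{-1}$. Let $M$ be a monoid. Let $F$ be the free restriction monoid on a copy $\{\lfloor m\rfloor : m\in M\}$ of the set $M$, let $I$ be the free inverse monoid on a copy $\{[m] : m\in M\}$ of the set $M$, and let $\kappa\colon F\to I$ be the homomorphism of restriction monoids with $\kappa(\lfloor m\rfloor)=[m]$ for all $m\in M$. A set $R$ of relations on $F$ (that is, a set of pairs of elements of $F$) is called \emph{admissible} if 1. the relations $\lfloor 1\rfloor=1$ and $\lfloor m\rfloor\lfloor n\rfloor=(\lfloor m\rfloor\lfloor n\rfloor)^+\lfloor mn\rfloor$ $(m,n\in M)$ belong to $R$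 or, more generally, follow from $R$, and 2. every relation in $R$ follows from the relations $\lfloor 1\rfloor=1$ and $\lfloor m\rfloor\lfloor n\rfloor=\lfloor mn\rfloor$ $(m,n\in M)$. Here a relation on $F$ \emph{follows} from a set of relations if it lies in the restriction-monoid congruence on $F$ generated by that set. For an admissible $R$, let $\mathcal{FR}_R(M)$ be the restriction monoid generated by the elements $\lfloor m\rfloor$, $m\in M$, subject to the relations $R$ (the quotient of $F$ by the congruence generated by $R$), let $\mathcal{FI}_R(M)$ be the inverse monoid generated by the elements $[m]$, $m\in M$, subject to the relations $\kappa(a)=\kappa(b)$ for $(a,b)\in R$, and let $\psi_R\colon \mathcal{FR}_R(M)\to\mathcal{FI}_R(M)$ be the homomorphism of restriction monoids determined by $\psi_R(\lfloor m\rfloor)=[m]$, $m\in M$. \textbf{Proposition.} Let $M$ be a monoid and $R$ a set of admissible relations. Then the following are equivalent: 1. $M$ embeds into a group; 2. the homomorphism $\psi_R\colon \mathcal{FR}_R(M)\to\mathcal{FI}_R(M)$ is injective. -/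

import Mathlib

universe u v

/-! ### Restriction monoids -/

/-- A (two-sided) restriction monoid, an algebra of type `(2,1,1,0)`; `rstar x` is `x^*` and
`rplus x` is `x^+`. -/
class RestrictionMonoid (S : Type u) extends Monoid S where
  rstar : S → S
  rplus : S → S
  mul_rstar_self : ∀ x : S, x * rstar x = x
  rstar_comm : ∀ x y : S, rstar x * rstar y = rstar y * rstar x
  rstar_mul_rstar : ∀ x y : S, rstar (x * rstar y) = rstar x * rstar y
  rstar_mul : ∀ x y : S, rstar x * y = y * rstar (x * y)
  rplus_mul_self : ∀ x : S, rplus x * x = x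
  rplus_comm : ∀ x y : S, rplus x * rplus y = rplus y * rplus x
  rplus_rplus_mul : ∀ x y : S, rplus (rplus x * y) = rplus x * rplus y
  mul_rplus : ∀ x y : S, x * rplus y = rplus (x * y) * x
  rstar_rplus : ∀ x : S, rstar (rplus x) = rplus x
  rplus_rstar : ∀ x : S, rplus (rstar x) = rstar x

/-- Homomorphisms of restriction monoids: maps preserving `*`, `1`, `^*` and `^+`. -/
structure RestrictionMonoidHom (S : Type u) (T : Type v) [RestrictionMonoid S]
    [RestrictionMonoid T] extends S →* T where
  map_rstar' : ∀ x : S, toFun (RestrictionMonoid.rstar x) = RestrictionMonoid.rstar (toFun x)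
  map_rplus' : ∀ x : S, toFun (RestrictionMonoid.rplus x) = RestrictionMonoid.rplus (toFun x)

instance {S : Type u} {T : Type v} [RestrictionMonoid S] [RestrictionMonoid T] :
    FunLike (RestrictionMonoidHom S T) S T where
  coe f := f.toFun
  coe_injective f g h := by
    obtain ⟨f, _, _⟩ := f
    obtain ⟨g, _, _⟩ := g
    have : f = g := DFunLike.coe_injective h
    subst this
    rfl

namespace RestrictionMonoid

variable {S : Type u} [RestrictionMonoid S]

/-- The least `(2,1,1,0)`-congruence on `S` containing the pairs in `R`: the pairs `(a, b)` such
that the relation `a = b` follows from the relations `R`. -/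
inductive CongGen (R : Set (S × S)) : S → S → Prop
  | of {a b : S} : (a, b) ∈ R → CongGen R a b
  | refl (a : S) : CongGen R a a
  | symm {a b : S} : CongGen R a b → CongGen R b a
  | trans {a b c : S} : CongGen R a b → CongGen R b c → CongGen R a c
  | mul {a b c d : S} : CongGen R a b → CongGen R c d → CongGen R (a * c) (b * d)
  | rstar {a b : S} : CongGen R a b → CongGen R (rstar a) (rstar b)
  | rplus {a b : S} : CongGen R a b → CongGen R (rplus a) (rplus b)

/-- `CongGen R` as a multiplicative congruence. -/
def cong (R : Set (S × S)) : Con S where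
  r := CongGen R
  iseqv := ⟨CongGen.refl, CongGen.symm, CongGen.trans⟩
  mul' := CongGen.mul

/-- The quotient of the restriction monoid `S` by the relations `R`. -/
def QuotientBy (R : Set (S × S)) : Type u := (cong R).Quotient

instance (R : Set (S × S)) : Monoid (QuotientBy R) :=
  inferInstanceAs (Monoid (cong R).Quotient)

/-- The quotient map. -/
def mkBy (R : Set (S × S)) : S →* QuotientBy R := (cong R).mk'

theorem mkBy_surjective (R : Set (S × S)) : Function.Surjective (mkBy R) :=
  Con.mk'_surjective

theorem mkBy_eq_iff (R : Set (S × S)) {a b : S} : mkBy R a = mkBy R b ↔ CongGen R a b :=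
  (cong R).eq

instance (R : Set (S × S)) : RestrictionMonoid (QuotientBy R) where
  rstar := Quotient.map (sa := (cong R).toSetoid) (sb := (cong R).toSetoid) rstar
    fun _ _ h => CongGen.rstar h
  rplus := Quotient.map (sa := (cong R).toSetoid) (sb := (cong R).toSetoid) rplus
    fun _ _ h => CongGen.rplus h
  mul_rstar_self := by
    rintro ⟨x⟩; exact congrArg (mkBy R) (mul_rstar_self x)
  rstar_comm := by
    rintro ⟨x⟩ ⟨y⟩; exact congrArg (mkBy R) (rstar_comm x y)
  rstar_mul_rstar := by
    rintro ⟨x⟩ ⟨y⟩; exact congrArg (mkBy R) (rstar_mul_rstar x y)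
  rstar_mul := by
    rintro ⟨x⟩ ⟨y⟩; exact congrArg (mkBy R) (rstar_mul x y)
  rplus_mul_self := by
    rintro ⟨x⟩; exact congrArg (mkBy R) (rplus_mul_self x)
  rplus_comm := by
    rintro ⟨x⟩ ⟨y⟩; exact congrArg (mkBy R) (rplus_comm x y)
  rplus_rplus_mul := by
    rintro ⟨x⟩ ⟨y⟩; exact congrArg (mkBy R) (rplus_rplus_mul x y)
  mul_rplus := by
    rintro ⟨x⟩ ⟨y⟩; exact congrArg (mkBy R) (mul_rplus x y)
  rstar_rplus := by
    rintro ⟨x⟩; exact congrArg (mkBy R) (rstar_rplus x)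
  rplus_rstar := by
    rintro ⟨x⟩; exact congrArg (mkBy R) (rplus_rstar x)

theorem mkBy_rstar (R : Set (S × S)) (a : S) : mkBy R (rstar a) = rstar (mkBy R a) := rfl

theorem mkBy_rplus (R : Set (S × S)) (a : S) : mkBy R (rplus a) = rplus (mkBy R a) := rfl

/-- A homomorphism that satisfies the relations `R` identifies all consequences of `R`. -/
theorem CongGen.map_eq {T : Type v} [RestrictionMonoid T] {R : Set (S × S)}
    (f : RestrictionMonoidHom S T) (hf : ∀ p ∈ R, f p.1 = f p.2) {a b : S}
    (h : CongGen R a b) : f a = f b := by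
  induction h with
  | of h => exact hf _ h
  | refl a => rfl
  | symm _ ih => exact ih.symm
  | trans _ _ ih₁ ih₂ => exact ih₁.trans ih₂
  | @mul a b c d _ _ ih₁ ih₂ =>
    exact (f.map_mul' a c).trans ((congrArg₂ (· * ·) ih₁ ih₂).trans (f.map_mul' b d).symm)
  | @rstar a b _ ih =>
    exact (f.map_rstar' a).trans ((congrArg RestrictionMonoid.rstar ih).trans
      (f.map_rstar' b).symm)
  | @rplus a b _ ih =>
    exact (f.map_rplus' a).trans ((congrArg RestrictionMonoid.rplus ih).trans
      (f.map_rplus' b).symm)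

/-- The homomorphism induced on `QuotientBy R` by a homomorphism satisfying the relations `R`. -/
def liftBy {T : Type v} [RestrictionMonoid T] (R : Set (S × S))
    (f : RestrictionMonoidHom S T) (hf : ∀ p ∈ R, f p.1 = f p.2) :
    RestrictionMonoidHom (QuotientBy R) T where
  toMonoidHom := (cong R).lift f.toMonoidHom fun _ _ h => CongGen.map_eq f hf h
  map_rstar' := by rintro ⟨x⟩; exact f.map_rstar' x
  map_rplus' := by rintro ⟨x⟩; exact f.map_rplus' x

end RestrictionMonoid

/-! ### Free restriction monoids -/

/-- Terms of type `(2,1,1,0)` over the set `X` of variables. -/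
inductive RTerm (X : Type u) : Type u
  | of : X → RTerm X
  | one : RTerm X
  | mul : RTerm X → RTerm X → RTerm X
  | rstar : RTerm X → RTerm X
  | rplus : RTerm X → RTerm X

namespace RTerm

/-- Equality of terms modulo the identities of restriction monoids. -/
inductive Rel {X : Type u} : RTerm X → RTerm X → Prop
  | refl (a) : Rel a a
  | symm {a b} : Rel a b → Rel b a
  | trans {a b c} : Rel a b → Rel b c → Rel a c
  | mul_congr {a b c d} : Rel a b → Rel c d → Rel (mul a c) (mul b d)
  | rstar_congr {a b} : Rel a b → Rel (rstar a) (rstar b)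
  | rplus_congr {a b} : Rel a b → Rel (rplus a) (rplus b)
  | mul_assoc (a b c) : Rel (mul (mul a b) c) (mul a (mul b c))
  | one_mul (a) : Rel (mul one a) a
  | mul_one (a) : Rel (mul a one) a
  | mul_rstar_self (x) : Rel (mul x (rstar x)) x
  | rstar_comm (x y) : Rel (mul (rstar x) (rstar y)) (mul (rstar y) (rstar x))
  | rstar_mul_rstar (x y) : Rel (rstar (mul x (rstar y))) (mul (rstar x) (rstar y))
  | rstar_mul (x y) : Rel (mul (rstar x) y) (mul y (rstar (mul x y)))
  | rplus_mul_self (x) : Rel (mul (rplus x) x) x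
  | rplus_comm (x y) : Rel (mul (rplus x) (rplus y)) (mul (rplus y) (rplus x))
  | rplus_rplus_mul (x y) : Rel (rplus (mul (rplus x) y)) (mul (rplus x) (rplus y))
  | mul_rplus (x y) : Rel (mul x (rplus y)) (mul (rplus (mul x y)) x)
  | rstar_rplus (x) : Rel (rstar (rplus x)) (rplus x)
  | rplus_rstar (x) : Rel (rplus (rstar x)) (rstar x)

/-- Terms modulo the identities of restriction monoids. -/
def setoid (X : Type u) : Setoid (RTerm X) := ⟨Rel, Rel.refl, Rel.symm, Rel.trans⟩

/-- The value of a term in a restriction monoid. -/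
def eval {X : Type u} {T : Type v} [RestrictionMonoid T] (f : X → T) : RTerm X → T
  | of x => f x
  | one => 1
  | mul a b => eval f a * eval f b
  | rstar a => RestrictionMonoid.rstar (eval f a)
  | rplus a => RestrictionMonoid.rplus (eval f a)

theorem Rel.eval_eq {X : Type u} {T : Type v} [RestrictionMonoid T] (f : X → T)
    {a b : RTerm X} (h : Rel a b) : eval f a = eval f b := by
  induction h with
  | refl => rfl
  | symm _ ih => exact ih.symm
  | trans _ _ ih₁ ih₂ => exact ih₁.trans ih₂
  | mul_congr _ _ ih₁ ih₂ => simp only [eval, ih₁, ih₂]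
  | rstar_congr _ ih => simp only [eval, ih]
  | rplus_congr _ ih => simp only [eval, ih]
  | mul_assoc => exact _root_.mul_assoc _ _ _
  | one_mul => exact _root_.one_mul _
  | mul_one => exact _root_.mul_one _
  | mul_rstar_self => exact RestrictionMonoid.mul_rstar_self _
  | rstar_comm => exact RestrictionMonoid.rstar_comm _ _
  | rstar_mul_rstar => exact RestrictionMonoid.rstar_mul_rstar _ _
  | rstar_mul => exact RestrictionMonoid.rstar_mul _ _
  | rplus_mul_self => exact RestrictionMonoid.rplus_mul_self _
  | rplus_comm => exact RestrictionMonoid.rplus_comm _ _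
  | rplus_rplus_mul => exact RestrictionMonoid.rplus_rplus_mul _ _
  | mul_rplus => exact RestrictionMonoid.mul_rplus _ _
  | rstar_rplus => exact RestrictionMonoid.rstar_rplus _
  | rplus_rstar => exact RestrictionMonoid.rplus_rstar _

end RTerm

/-- The free restriction monoid on the set `X`. -/
def FreeRestrictionMonoid (X : Type u) : Type u := Quotient (RTerm.setoid X)

namespace FreeRestrictionMonoid

/-- The class of a term. -/
def mk {X : Type u} (t : RTerm X) : FreeRestrictionMonoid X := Quotient.mk (RTerm.setoid X) t

theorem mk_eq {X : Type u} {s t : RTerm X} (h : RTerm.Rel s t) : mk s = mk t := Quotient.sound h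

instance (X : Type u) : RestrictionMonoid (FreeRestrictionMonoid X) where
  one := mk .one
  mul := Quotient.map₂ (sa := RTerm.setoid X) (sb := RTerm.setoid X) (sc := RTerm.setoid X)
    RTerm.mul fun _ _ h₁ _ _ h₂ => RTerm.Rel.mul_congr h₁ h₂
  rstar := Quotient.map (sa := RTerm.setoid X) (sb := RTerm.setoid X) RTerm.rstar
    fun _ _ h => RTerm.Rel.rstar_congr h
  rplus := Quotient.map (sa := RTerm.setoid X) (sb := RTerm.setoid X) RTerm.rplus
    fun _ _ h => RTerm.Rel.rplus_congr h
  mul_assoc := by rintro ⟨a⟩ ⟨b⟩ ⟨c⟩; exact mk_eq (.mul_assoc a b c)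
  one_mul := by rintro ⟨a⟩; exact mk_eq (.one_mul a)
  mul_one := by rintro ⟨a⟩; exact mk_eq (.mul_one a)
  mul_rstar_self := by rintro ⟨a⟩; exact mk_eq (.mul_rstar_self a)
  rstar_comm := by rintro ⟨a⟩ ⟨b⟩; exact mk_eq (.rstar_comm a b)
  rstar_mul_rstar := by rintro ⟨a⟩ ⟨b⟩; exact mk_eq (.rstar_mul_rstar a b)
  rstar_mul := by rintro ⟨a⟩ ⟨b⟩; exact mk_eq (.rstar_mul a b)
  rplus_mul_self := by rintro ⟨a⟩; exact mk_eq (.rplus_mul_self a)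
  rplus_comm := by rintro ⟨a⟩ ⟨b⟩; exact mk_eq (.rplus_comm a b)
  rplus_rplus_mul := by rintro ⟨a⟩ ⟨b⟩; exact mk_eq (.rplus_rplus_mul a b)
  mul_rplus := by rintro ⟨a⟩ ⟨b⟩; exact mk_eq (.mul_rplus a b)
  rstar_rplus := by rintro ⟨a⟩; exact mk_eq (.rstar_rplus a)
  rplus_rstar := by rintro ⟨a⟩; exact mk_eq (.rplus_rstar a)

/-- The free generators. -/
def of {X : Type u} (x : X) : FreeRestrictionMonoid X := mk (.of x)

/-- The homomorphism extending a map on the free generators. -/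
def lift {X : Type u} {T : Type v} [RestrictionMonoid T] (f : X → T) :
    RestrictionMonoidHom (FreeRestrictionMonoid X) T where
  toFun := Quotient.lift (s := RTerm.setoid X) (RTerm.eval f) fun _ _ h => RTerm.Rel.eval_eq f h
  map_one' := rfl
  map_mul' := by rintro ⟨a⟩ ⟨b⟩; rfl
  map_rstar' := by rintro ⟨a⟩; rfl
  map_rplus' := by rintro ⟨a⟩; rfl

theorem lift_of {X : Type u} {T : Type v} [RestrictionMonoid T] (f : X → T) (x : X) :
    lift f (of x) = f x := rfl

end FreeRestrictionMonoid

/-! ### Inverse monoids -/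

/-- An inverse monoid, an algebra of type `(2,1,0)`. -/
class InverseMonoid (S : Type u) extends Monoid S, Inv S where
  inv_invol : ∀ x : S, x⁻¹⁻¹ = x
  inv_anti : ∀ x y : S, (x * y)⁻¹ = y⁻¹ * x⁻¹
  mul_inv_mul_self : ∀ x : S, x * x⁻¹ * x = x
  mul_inv_comm : ∀ x y : S, x * x⁻¹ * (y * y⁻¹) = y * y⁻¹ * (x * x⁻¹)

namespace InverseMonoid

variable {S : Type u} [InverseMonoid S]

theorem inv_mul_self_mul_inv (x : S) : x⁻¹ * (x * x⁻¹) = x⁻¹ := by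
  have h := mul_inv_mul_self x⁻¹
  rwa [inv_invol, mul_assoc] at h

theorem mul_inv_mul_self' (x : S) : x * (x⁻¹ * x) = x := by
  rw [← mul_assoc, mul_inv_mul_self]

theorem inv_mul_comm (x y : S) : x⁻¹ * x * (y⁻¹ * y) = y⁻¹ * y * (x⁻¹ * x) := by
  have h := mul_inv_comm x⁻¹ y⁻¹
  rwa [inv_invol, inv_invol] at h

theorem inv_mul_comm_mul_inv (x y : S) : x⁻¹ * x * (y * y⁻¹) = y * y⁻¹ * (x⁻¹ * x) := by
  have h := mul_inv_comm x⁻¹ y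
  rwa [inv_invol] at h

/-- An inverse monoid is a restriction monoid with `x^* = x⁻¹ x` and `x^+ = x x⁻¹`. -/
instance toRestrictionMonoid : RestrictionMonoid S where
  rstar x := x⁻¹ * x
  rplus x := x * x⁻¹
  mul_rstar_self := mul_inv_mul_self'
  rstar_comm := inv_mul_comm
  rstar_mul_rstar x y := by
    calc (x * (y⁻¹ * y))⁻¹ * (x * (y⁻¹ * y))
        = y⁻¹ * y * (x⁻¹ * x) * (y⁻¹ * y) := by
          simp only [inv_anti, inv_invol, mul_assoc]
      _ = x⁻¹ * x * (y⁻¹ * (y * (y⁻¹ * y))) := by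
          rw [← inv_mul_comm]; simp only [mul_assoc]
      _ = x⁻¹ * x * (y⁻¹ * y) := by rw [mul_inv_mul_self']
  rstar_mul x y := by
    calc x⁻¹ * x * y = x⁻¹ * x * (y * y⁻¹) * y := by
          rw [mul_assoc (x⁻¹ * x), mul_inv_mul_self]
      _ = y * ((x * y)⁻¹ * (x * y)) := by
          rw [inv_mul_comm_mul_inv, inv_anti]; simp only [mul_assoc]
  rplus_mul_self := mul_inv_mul_self
  rplus_comm := mul_inv_comm
  rplus_rplus_mul x y := by
    calc x * x⁻¹ * y * (x * x⁻¹ * y)⁻¹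
        = x * x⁻¹ * (y * y⁻¹ * (x * x⁻¹)) := by
          simp only [inv_anti, inv_invol, mul_assoc]
      _ = x * (x⁻¹ * (x * x⁻¹)) * (y * y⁻¹) := by
          rw [← mul_inv_comm]; simp only [mul_assoc]
      _ = x * x⁻¹ * (y * y⁻¹) := by rw [inv_mul_self_mul_inv]
  mul_rplus x y := by
    calc x * (y * y⁻¹) = x * (x⁻¹ * x * (y * y⁻¹)) := by
          rw [← mul_assoc x (x⁻¹ * x), mul_inv_mul_self']
      _ = x * y * (x * y)⁻¹ * x := by
          rw [inv_mul_comm_mul_inv, inv_anti]; simp only [mul_assoc]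
  rstar_rplus x := by
    rw [inv_anti, inv_invol, mul_assoc, inv_mul_self_mul_inv]
  rplus_rstar x := by
    rw [inv_anti, inv_invol, mul_assoc, mul_inv_mul_self']

/-- The least `(2,1,0)`-congruence on `S` containing the pairs in `R`. -/
inductive CongGen (R : Set (S × S)) : S → S → Prop
  | of {a b : S} : (a, b) ∈ R → CongGen R a b
  | refl (a : S) : CongGen R a a
  | symm {a b : S} : CongGen R a b → CongGen R b a
  | trans {a b c : S} : CongGen R a b → CongGen R b c → CongGen R a c
  | mul {a b c d : S} : CongGen R a b → CongGen R c d → CongGen R (a * c) (b * d)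
  | inv {a b : S} : CongGen R a b → CongGen R a⁻¹ b⁻¹

/-- `CongGen R` as a multiplicative congruence. -/
def cong (R : Set (S × S)) : Con S where
  r := CongGen R
  iseqv := ⟨CongGen.refl, CongGen.symm, CongGen.trans⟩
  mul' := CongGen.mul

/-- The quotient of the inverse monoid `S` by the relations `R`. -/
def QuotientBy (R : Set (S × S)) : Type u := (cong R).Quotient

instance (R : Set (S × S)) : Monoid (QuotientBy R) :=
  inferInstanceAs (Monoid (cong R).Quotient)

/-- The quotient map. -/
def mkBy (R : Set (S × S)) : S →* QuotientBy R := (cong R).mk'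

theorem mkBy_surjective (R : Set (S × S)) : Function.Surjective (mkBy R) :=
  Con.mk'_surjective

theorem mkBy_eq_iff (R : Set (S × S)) {a b : S} : mkBy R a = mkBy R b ↔ CongGen R a b :=
  (cong R).eq

instance (R : Set (S × S)) : InverseMonoid (QuotientBy R) where
  inv := Quotient.map (sa := (cong R).toSetoid) (sb := (cong R).toSetoid) (fun x => x⁻¹)
    fun _ _ h => CongGen.inv h
  inv_invol := by rintro ⟨x⟩; exact congrArg (mkBy R) (inv_invol x)
  inv_anti := by rintro ⟨x⟩ ⟨y⟩; exact congrArg (mkBy R) (inv_anti x y)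
  mul_inv_mul_self := by rintro ⟨x⟩; exact congrArg (mkBy R) (mul_inv_mul_self x)
  mul_inv_comm := by rintro ⟨x⟩ ⟨y⟩; exact congrArg (mkBy R) (mul_inv_comm x y)

theorem mkBy_inv (R : Set (S × S)) (a : S) : mkBy R a⁻¹ = (mkBy R a)⁻¹ := rfl

end InverseMonoid

/-! ### Free inverse monoids -/

/-- Terms of type `(2,1,0)` over the set `X` of variables. -/
inductive ITerm (X : Type u) : Type u
  | of : X → ITerm X
  | one : ITerm X
  | mul : ITerm X → ITerm X → ITerm X
  | inv : ITerm X → ITerm X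

namespace ITerm

/-- Equality of terms modulo the identities of inverse monoids. -/
inductive Rel {X : Type u} : ITerm X → ITerm X → Prop
  | refl (a) : Rel a a
  | symm {a b} : Rel a b → Rel b a
  | trans {a b c} : Rel a b → Rel b c → Rel a c
  | mul_congr {a b c d} : Rel a b → Rel c d → Rel (mul a c) (mul b d)
  | inv_congr {a b} : Rel a b → Rel (inv a) (inv b)
  | mul_assoc (a b c) : Rel (mul (mul a b) c) (mul a (mul b c))
  | one_mul (a) : Rel (mul one a) a
  | mul_one (a) : Rel (mul a one) a
  | inv_invol (x) : Rel (inv (inv x)) x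
  | inv_anti (x y) : Rel (inv (mul x y)) (mul (inv y) (inv x))
  | mul_inv_mul_self (x) : Rel (mul (mul x (inv x)) x) x
  | mul_inv_comm (x y) :
      Rel (mul (mul x (inv x)) (mul y (inv y))) (mul (mul y (inv y)) (mul x (inv x)))

/-- Terms modulo the identities of inverse monoids. -/
def setoid (X : Type u) : Setoid (ITerm X) := ⟨Rel, Rel.refl, Rel.symm, Rel.trans⟩

end ITerm

/-- The free inverse monoid on the set `X`. -/
def FreeInverseMonoid (X : Type u) : Type u := Quotient (ITerm.setoid X)

namespace FreeInverseMonoid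

/-- The class of a term. -/
def mk {X : Type u} (t : ITerm X) : FreeInverseMonoid X := Quotient.mk (ITerm.setoid X) t

theorem mk_eq {X : Type u} {s t : ITerm X} (h : ITerm.Rel s t) : mk s = mk t := Quotient.sound h

instance (X : Type u) : InverseMonoid (FreeInverseMonoid X) where
  one := mk .one
  mul := Quotient.map₂ (sa := ITerm.setoid X) (sb := ITerm.setoid X) (sc := ITerm.setoid X)
    ITerm.mul fun _ _ h₁ _ _ h₂ => ITerm.Rel.mul_congr h₁ h₂
  inv := Quotient.map (sa := ITerm.setoid X) (sb := ITerm.setoid X) ITerm.inv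
    fun _ _ h => ITerm.Rel.inv_congr h
  mul_assoc := by rintro ⟨a⟩ ⟨b⟩ ⟨c⟩; exact mk_eq (.mul_assoc a b c)
  one_mul := by rintro ⟨a⟩; exact mk_eq (.one_mul a)
  mul_one := by rintro ⟨a⟩; exact mk_eq (.mul_one a)
  inv_invol := by rintro ⟨a⟩; exact mk_eq (.inv_invol a)
  inv_anti := by rintro ⟨a⟩ ⟨b⟩; exact mk_eq (.inv_anti a b)
  mul_inv_mul_self := by rintro ⟨a⟩; exact mk_eq (.mul_inv_mul_self a)
  mul_inv_comm := by rintro ⟨a⟩ ⟨b⟩; exact mk_eq (.mul_inv_comm a b)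

/-- The free generators. -/
def of {X : Type u} (x : X) : FreeInverseMonoid X := mk (.of x)

end FreeInverseMonoid

/-! ### Free restriction and inverse monoids over a monoid -/

namespace MonoidExpansion

open FreeRestrictionMonoid (of)
open RestrictionMonoid (rplus)

/-- The relations `⌊1⌋ = 1` and `⌊m⌋⌊n⌋ = (⌊m⌋⌊n⌋)^+ ⌊mn⌋`, which define premorphisms. -/
def premorphismRelations (M : Type u) [Monoid M] :
    Set (FreeRestrictionMonoid M × FreeRestrictionMonoid M) :=
  {((of 1 : FreeRestrictionMonoid M), 1)} ∪
    Set.range fun p : M × M => (of p.1 * of p.2, rplus (of p.1 * of p.2) * of (p.1 * p.2))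

/-- The relations `⌊1⌋ = 1` and `⌊m⌋⌊n⌋ = ⌊mn⌋`, which define homomorphisms. -/
def homomorphismRelations (M : Type u) [Monoid M] :
    Set (FreeRestrictionMonoid M × FreeRestrictionMonoid M) :=
  {((of 1 : FreeRestrictionMonoid M), 1)} ∪
    Set.range fun p : M × M => (of p.1 * of p.2, of (p.1 * p.2))

/-- Sets of admissible relations. The premorphism relations need not be listed in `R` literally,
it is enough that they follow from `R`. -/
structure IsAdmissible {M : Type u} [Monoid M]
    (R : Set (FreeRestrictionMonoid M × FreeRestrictionMonoid M)) : Prop where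
  premorphism : ∀ p ∈ premorphismRelations M, RestrictionMonoid.CongGen R p.1 p.2
  homomorphism : ∀ p ∈ R, RestrictionMonoid.CongGen (homomorphismRelations M) p.1 p.2

/-- The restriction monoid `FR_R(M)` generated by `⌊m⌋`, `m ∈ M`, subject to the relations `R`. -/
abbrev FR {M : Type u} [Monoid M]
    (R : Set (FreeRestrictionMonoid M × FreeRestrictionMonoid M)) : Type u :=
  RestrictionMonoid.QuotientBy R

/-- The canonical homomorphism `⌊m⌋ ↦ [m]` from the free restriction monoid to the free inverse
monoid on the set `M`. -/
def toFreeInverse (M : Type u) :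
    RestrictionMonoidHom (FreeRestrictionMonoid M) (FreeInverseMonoid M) :=
  FreeRestrictionMonoid.lift FreeInverseMonoid.of

/-- The images of the relations `R` in the free inverse monoid on `M`. -/
def imageRelations {M : Type u}
    (R : Set (FreeRestrictionMonoid M × FreeRestrictionMonoid M)) :
    Set (FreeInverseMonoid M × FreeInverseMonoid M) :=
  (fun p => (toFreeInverse M p.1, toFreeInverse M p.2)) '' R

/-- The inverse monoid `FI_R(M)` generated by `[m]`, `m ∈ M`, subject to the images of the
relations `R`. -/
abbrev FI {M : Type u} [Monoid M]
    (R : Set (FreeRestrictionMonoid M × FreeRestrictionMonoid M)) : Type u :=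
  InverseMonoid.QuotientBy (imageRelations R)

/-- The map `m ↦ ⌊m⌋` from `M` to `FR_R(M)`. -/
def iotaFR {M : Type u} [Monoid M]
    (R : Set (FreeRestrictionMonoid M × FreeRestrictionMonoid M)) (m : M) : FR R :=
  RestrictionMonoid.mkBy R (of m)

/-- The map `m ↦ [m]` from `M` to `FI_R(M)`. -/
def iotaFI {M : Type u} [Monoid M]
    (R : Set (FreeRestrictionMonoid M × FreeRestrictionMonoid M)) (m : M) : FI R :=
  InverseMonoid.mkBy (imageRelations R) (FreeInverseMonoid.of m)

theorem lift_iotaFI {M : Type u} [Monoid M]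
    (R : Set (FreeRestrictionMonoid M × FreeRestrictionMonoid M)) (a : FreeRestrictionMonoid M) :
    FreeRestrictionMonoid.lift (iotaFI R) a =
      InverseMonoid.mkBy (imageRelations R) (toFreeInverse M a) := by
  obtain ⟨t⟩ := a
  change RTerm.eval (iotaFI R) t =
    InverseMonoid.mkBy (imageRelations R) (RTerm.eval FreeInverseMonoid.of t)
  induction t with
  | of x => rfl
  | one => rfl
  | mul a b iha ihb => exact congrArg₂ (· * ·) iha ihb
  | rstar a ih => exact congrArg RestrictionMonoid.rstar ih
  | rplus a ih => exact congrArg RestrictionMonoid.rplus ih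

/-- The homomorphism of restriction monoids `ψ_R : FR_R(M) → FI_R(M)` given by `⌊m⌋ ↦ [m]`. -/
def psi {M : Type u} [Monoid M]
    (R : Set (FreeRestrictionMonoid M × FreeRestrictionMonoid M)) :
    RestrictionMonoidHom (FR R) (FI R) :=
  RestrictionMonoid.liftBy R (FreeRestrictionMonoid.lift (iotaFI R)) fun p hp => by
    rw [lift_iotaFI, lift_iotaFI, InverseMonoid.mkBy_eq_iff]
    exact InverseMonoid.CongGen.of ⟨p, hp, rfl⟩

theorem psi_iotaFR {M : Type u} [Monoid M]
    (R : Set (FreeRestrictionMonoid M × FreeRestrictionMonoid M)) (m : M) :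
    psi R (iotaFR R m) = iotaFI R m := rfl

end MonoidExpansion

/-! ### Computations in restriction monoids -/

/-! The link between the two conditions is that `ψ_R` is always injective on projections. The Munn
representation sends `x` to the partial bijection `e ↦ (xe)^+` of the projections below `x^*`. It
takes values in an inverse monoid, so on `FR_R(M)` it factors through `ψ_R`, and it separates
projections (`psi_injective_on_projections`).

Let `M` embed into a group `G`. The premorphism relations put every `a` in the form `a^+⌊m⌋`
(`exists_eq_rplus_mul_iotaFR`). The relations `R` hold in `G`, so there is a homomorphism `FI_R(M) →
G`, and it takes `ψ_R(a)` to the image of `m`. Thus `ψ_R(a)` determines `m`, and it determines `a^+`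
by injectivity on projections; hence it determines `a`.

Conversely, send `m` to the class of `[m]` in the greatest group image of `FI_R(M)`. If `m` and `n`
have the same image, then `z^+[m] = z^+[n]` for some `z`. Every `z^+` is some `ψ_R(q^+)`
(`exists_psi_rplus_eq`), so injectivity of `ψ_R` gives `q^+⌊m⌋ = q^+⌊n⌋`. The homomorphism `FR_R(M)
→ M` that collapses all projections to `1` then yields `m = n`. -/

namespace RestrictionMonoidHom

variable {S : Type u} {T : Type v} [RestrictionMonoid S] [RestrictionMonoid T]
  (f : RestrictionMonoidHom S T)

theorem map_one : f 1 = 1 := f.map_one'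

theorem map_mul (x y : S) : f (x * y) = f x * f y := f.map_mul' x y

theorem map_rstar (x : S) : f (RestrictionMonoid.rstar x) = RestrictionMonoid.rstar (f x) :=
  f.map_rstar' x

theorem map_rplus (x : S) : f (RestrictionMonoid.rplus x) = RestrictionMonoid.rplus (f x) :=
  f.map_rplus' x

/-- Composition of homomorphisms of restriction monoids. -/
def comp {U : Type*} [RestrictionMonoid U] (g : RestrictionMonoidHom T U)
    (f : RestrictionMonoidHom S T) : RestrictionMonoidHom S U where
  toMonoidHom := g.toMonoidHom.comp f.toMonoidHom
  map_rstar' x := (congrArg g (f.map_rstar x)).trans (g.map_rstar _)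
  map_rplus' x := (congrArg g (f.map_rplus x)).trans (g.map_rplus _)

end RestrictionMonoidHom

namespace RestrictionMonoid

variable {S : Type u} [RestrictionMonoid S]

theorem rplus_rplus (x : S) : rplus (rplus x) = rplus x := by
  rw [← rstar_rplus x, rplus_rstar]

theorem rstar_rstar (x : S) : rstar (rstar x) = rstar x := by
  rw [← rplus_rstar x, rstar_rplus]

theorem rplus_mul_self_rplus (x : S) : rplus x * rplus x = rplus x := by
  rw [← rplus_rplus_mul, rplus_mul_self]

theorem rstar_one : rstar (1 : S) = 1 := by
  simpa using mul_rstar_self (1 : S)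

theorem rplus_one : rplus (1 : S) = 1 := by
  simpa using rplus_mul_self (1 : S)

theorem rplus_mul_rplus (x y : S) : rplus (x * rplus y) = rplus (x * y) := by
  rw [mul_rplus, rplus_rplus_mul, rplus_comm, ← rplus_rplus_mul, ← mul_assoc, rplus_mul_self]

theorem rplus_absorb (x y : S) : rplus x * rplus (x * y) = rplus (x * y) := by
  rw [← rplus_rplus_mul, ← mul_assoc, rplus_mul_self]

theorem rstar_absorb (x y : S) : rstar (x * y) * rstar y = rstar (x * y) := by
  rw [← rstar_mul_rstar, mul_assoc, mul_rstar_self]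

/-! ### Projections and the Munn representation -/

/-- The projections of a restriction monoid. -/
abbrev Projection (S : Type u) [RestrictionMonoid S] : Type u := {e : S // rplus e = e}

theorem Projection.rplus_eq (e : Projection S) : rplus e.1 = e.1 := e.2

theorem Projection.rstar_eq (e : Projection S) : rstar e.1 = e.1 := by
  rw [← e.rplus_eq, rstar_rplus]

theorem rstar_mul_projection (x : S) (e : Projection S) : rstar (x * e.1) = rstar x * e.1 := by
  conv_lhs => rw [← e.rstar_eq]
  rw [rstar_mul_rstar, e.rstar_eq]

theorem rplus_projection_mul (x : S) (e : Projection S) : rplus (e.1 * x) = e.1 * rplus x := by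
  conv_lhs => rw [← e.rplus_eq]
  rw [rplus_rplus_mul, e.rplus_eq]

theorem mul_projection (x : S) (e : Projection S) : x * e.1 = rplus (x * e.1) * x := by
  have h := mul_rplus x e.1
  rwa [e.rplus_eq] at h

theorem projection_mul (x : S) (e : Projection S) : e.1 * x = x * rstar (e.1 * x) := by
  have h := rstar_mul e.1 x
  rwa [e.rstar_eq] at h

theorem projection_comm (x : S) (e : Projection S) : e.1 * rplus x = rplus x * e.1 := by
  rw [← e.rplus_eq, rplus_comm]

open Classical in
/-- The partial bijection of the projections induced by an element: `e ↦ (xe)^+` for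
`e ≤ x^*`. -/
noncomputable def munn (x : S) : Projection S ≃. Projection S where
  -- The condition says `e ≤ x^*` in the semilattice of projections; in the inverse map it is `e ≤
  -- x^+`.
  toFun e := if rstar x * e.1 = e.1 then some ⟨rplus (x * e.1), rplus_rplus _⟩ else none
  invFun e := if rplus x * e.1 = e.1 then some ⟨rstar (e.1 * x), rplus_rstar _⟩ else none
  inv e f := by
    simp only [Option.ite_none_right_eq_some]
    constructor
    · rintro ⟨h, h'⟩
      obtain rfl := Option.some.inj h'
      refine ⟨?_, congrArg some (Subtype.ext ?_)⟩
      · change rstar x * rstar (f.1 * x) = rstar (f.1 * x)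
        rw [rstar_comm, rstar_absorb]
      · change rplus (x * rstar (f.1 * x)) = f.1
        rw [← projection_mul, rplus_projection_mul, projection_comm, h]
    · rintro ⟨h, h'⟩
      obtain rfl := Option.some.inj h'
      refine ⟨?_, congrArg some (Subtype.ext ?_)⟩
      · exact rplus_absorb _ _
      · change rstar (rplus (x * e.1) * x) = e.1
        rw [← mul_projection, rstar_mul_projection, h]

theorem munn_eq_some {x : S} {e f : Projection S} :
    munn x e = some f ↔ rstar x * e.1 = e.1 ∧ rplus (x * e.1) = f.1 := by
  simp only [munn, PEquiv.coe_mk, Option.ite_none_right_eq_some, Option.some_inj,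
    Subtype.ext_iff]

theorem munn_symm_eq_some {x : S} {e f : Projection S} :
    (munn x).symm e = some f ↔ rplus x * e.1 = e.1 ∧ rstar (e.1 * x) = f.1 := by
  simp only [munn, PEquiv.symm, PEquiv.coe_mk, Option.ite_none_right_eq_some, Option.some_inj,
    Subtype.ext_iff]

theorem munn_one : munn (1 : S) = PEquiv.refl _ := by
  refine PEquiv.ext fun e => ?_
  rw [PEquiv.refl_apply, munn_eq_some, rstar_one, one_mul, e.rplus_eq]
  exact ⟨rfl, rfl⟩

/-- The values agree because `(x(ye)^+)^+ = (xye)^+`. The point is that the domains agree: `e ≤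
(xy)^*` exactly when `e ≤ y^*` and `(ye)^+ ≤ x^*`. Both directions rest on `x^*y = y(xy)^*`. -/
theorem munn_mul (x y : S) : munn (x * y) = (munn y).trans (munn x) := by
  refine PEquiv.ext fun e => Option.ext fun f => ?_
  rw [PEquiv.trans_eq_some, munn_eq_some]
  have hval : rplus (x * rplus (y * e.1)) = rplus (x * y * e.1) := by
    rw [rplus_mul_rplus, mul_assoc]
  constructor
  · rintro ⟨h, hf⟩
    refine ⟨⟨rplus (y * e.1), rplus_rplus _⟩, munn_eq_some.2 ⟨?_, rfl⟩,
      munn_eq_some.2 ⟨?_, hval.trans hf⟩⟩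
    · rw [← h, ← mul_assoc, rstar_comm, rstar_absorb]
    · change rstar x * rplus (y * e.1) = rplus (y * e.1)
      rw [← rplus_rstar x, ← rplus_rplus_mul, rplus_rstar, ← mul_assoc, rstar_mul, mul_assoc, h]
  · rintro ⟨g, hg, hf⟩
    obtain ⟨h, hg⟩ := munn_eq_some.1 hg
    obtain ⟨h', hf⟩ := munn_eq_some.1 hf
    rw [← hg] at h' hf
    refine ⟨?_, hval.symm.trans hf⟩
    -- Here `y(xy)^*e = x^*ye`, and `x^*` fixes `ye` because it fixes `(ye)^+`. Applying `^*` to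
    -- both sides recovers `(xy)^*e = e`.
    have key : y * (rstar (x * y) * e.1) = y * e.1 := by
      rw [← mul_assoc, ← rstar_mul, mul_assoc, ← rplus_mul_self (y * e.1), ← mul_assoc, h']
    have key' := congrArg rstar key
    rwa [← mul_assoc, rstar_mul_projection, rstar_mul_rstar, rstar_mul_projection, h, rstar_comm,
      rstar_absorb] at key'

/-- Both sides are the identity on the projections below `x^*`. -/
theorem munn_rstar (x : S) : munn (rstar x) = (munn x).trans (munn x).symm := by
  refine PEquiv.ext fun e => Option.ext fun f => ?_
  rw [PEquiv.trans_eq_some, munn_eq_some, rstar_rstar]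
  constructor
  · rintro ⟨h, hf⟩
    rw [h, e.rplus_eq] at hf
    obtain rfl := Subtype.ext hf
    have : munn x e = some ⟨rplus (x * e.1), rplus_rplus _⟩ := munn_eq_some.2 ⟨h, rfl⟩
    exact ⟨_, this, (PEquiv.eq_some_iff _).2 this⟩
  · rintro ⟨g, hg, hf⟩
    obtain rfl := PEquiv.inj _ hg ((PEquiv.eq_some_iff _).1 hf)
    have h := (munn_eq_some.1 hg).1
    exact ⟨h, by rw [h, e.rplus_eq]⟩

theorem munn_rplus (x : S) : munn (rplus x) = (munn x).symm.trans (munn x) := by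
  refine PEquiv.ext fun e => Option.ext fun f => ?_
  rw [PEquiv.trans_eq_some, munn_eq_some, rstar_rplus]
  constructor
  · rintro ⟨h, hf⟩
    rw [h, e.rplus_eq] at hf
    obtain rfl := Subtype.ext hf
    have : (munn x).symm e = some ⟨rstar (e.1 * x), rplus_rstar _⟩ :=
      munn_symm_eq_some.2 ⟨h, rfl⟩
    exact ⟨_, this, (PEquiv.eq_some_iff _).1 this⟩
  · rintro ⟨g, hg, hf⟩
    obtain rfl := Option.some.inj (((PEquiv.eq_some_iff _).1 hg).symm.trans hf)
    have h := (munn_symm_eq_some.1 hg).1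
    exact ⟨h, by rw [h, e.rplus_eq]⟩

/-- A projection `e` acts as the identity on the projections below it, so its domain has `e` as
greatest element. -/
theorem munn_injective_on_projections {e f : Projection S} (h : munn e.1 = munn f.1) :
    e = f := by
  have aux : ∀ {e f : Projection S}, munn e.1 = munn f.1 → f.1 * e.1 = e.1 := fun {e f} h => by
    have hee : e.1 * e.1 = e.1 := by simpa only [e.rplus_eq] using rplus_mul_self_rplus e.1
    have he : munn e.1 e = some e := munn_eq_some.2 (by
      rw [e.rstar_eq, hee, e.rplus_eq]
      exact ⟨rfl, rfl⟩)
    rw [h, munn_eq_some, f.rstar_eq] at he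
    exact he.1
  refine Subtype.ext ?_
  have hc := projection_comm e.1 f
  rw [e.rplus_eq, aux h, aux h.symm] at hc
  exact hc

end RestrictionMonoid

/-! ### Inverse monoids: examples and homomorphisms -/

/-- The partial bijections of a set form an inverse monoid under composition of functions. -/
instance PEquiv.instInverseMonoid (α : Type u) : InverseMonoid (α ≃. α) where
  -- Right-to-left composition makes the Munn representation a homomorphism instead of an
  -- antihomomorphism.
  mul f g := g.trans f
  one := PEquiv.refl α
  inv f := f.symm
  mul_assoc f g h := (PEquiv.trans_assoc h g f).symm
  one_mul f := PEquiv.trans_refl f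
  mul_one f := PEquiv.refl_trans f
  inv_invol _ := rfl
  inv_anti _ _ := rfl
  mul_inv_mul_self f := by
    refine PEquiv.ext fun a => Option.ext fun b => ?_
    change f.trans (f.symm.trans f) a = some b ↔ _
    simp only [PEquiv.trans_eq_some, PEquiv.eq_some_iff]
    constructor
    · rintro ⟨c, hc, d, hd, hb⟩
      rw [← PEquiv.inj f hc hd] at hb
      exact hb
    · exact fun h => ⟨b, h, a, h, h⟩
  mul_inv_comm f g := by
    refine PEquiv.ext fun a => Option.ext fun b => ?_
    change (g.symm.trans g).trans (f.symm.trans f) a = some b ↔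
      (f.symm.trans f).trans (g.symm.trans g) a = some b
    classical
    -- Both factors are partial identities; composed in either order they give the identity on the
    -- intersection of their domains.
    simp only [PEquiv.symm_trans_self, PEquiv.trans_eq_some, PEquiv.ofSet_eq_some_iff]
    constructor
    all_goals
      rintro ⟨c, ⟨rfl, h⟩, rfl, h'⟩
      exact ⟨_, ⟨rfl, h'⟩, rfl, h⟩

/-- A group as an inverse monoid. -/
abbrev InverseMonoid.ofGroup (G : Type u) [Group G] : InverseMonoid G where
  inv_invol := inv_inv
  inv_anti := mul_inv_rev
  mul_inv_mul_self := by simp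
  mul_inv_comm := by simp

/-- A monoid as a restriction monoid with a single projection. -/
abbrev RestrictionMonoid.trivial (M : Type u) [Monoid M] : RestrictionMonoid M where
  rstar _ := 1
  rplus _ := 1
  mul_rstar_self := mul_one
  rstar_comm _ _ := rfl
  rstar_mul_rstar _ _ := (mul_one 1).symm
  rstar_mul _ y := (one_mul y).trans (mul_one y).symm
  rplus_mul_self := one_mul
  rplus_comm _ _ := rfl
  rplus_rplus_mul _ _ := (mul_one 1).symm
  mul_rplus x _ := (mul_one x).trans (one_mul x).symm
  rstar_rplus _ := rfl
  rplus_rstar _ := rfl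

/-! ### Universal properties of quotients and free objects -/

/-- Homomorphisms of inverse monoids. -/
structure InverseMonoidHom (S : Type u) (T : Type v) [InverseMonoid S] [InverseMonoid T]
    extends S →* T where
  map_inv' : ∀ x : S, toFun x⁻¹ = (toFun x)⁻¹

/-- Homomorphisms of inverse monoids preserve the operations of restriction monoids. -/
def InverseMonoidHom.toRestrictionMonoidHom {S : Type u} {T : Type v} [InverseMonoid S]
    [InverseMonoid T] (f : InverseMonoidHom S T) : RestrictionMonoidHom S T where
  toMonoidHom := f.toMonoidHom
  map_rstar' x := (f.map_mul' x⁻¹ x).trans (congrArg (· * f.toFun x) (f.map_inv' x))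
  map_rplus' x := (f.map_mul' x x⁻¹).trans (congrArg (f.toFun x * ·) (f.map_inv' x))

theorem InverseMonoid.CongGen.map_eq {S : Type u} {T : Type v} [InverseMonoid S]
    [InverseMonoid T] {R : Set (S × S)} (f : InverseMonoidHom S T)
    (hf : ∀ p ∈ R, f.toMonoidHom p.1 = f.toMonoidHom p.2) {a b : S}
    (h : InverseMonoid.CongGen R a b) : f.toMonoidHom a = f.toMonoidHom b := by
  induction h with
  | of h => exact hf _ h
  | refl a => rfl
  | symm _ ih => exact ih.symm
  | trans _ _ ih₁ ih₂ => exact ih₁.trans ih₂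
  | mul _ _ ih₁ ih₂ => rw [map_mul, map_mul, ih₁, ih₂]
  | @inv a b _ ih => exact (f.map_inv' a).trans ((congrArg (·⁻¹) ih).trans (f.map_inv' b).symm)

/-- The homomorphism induced on a quotient of an inverse monoid. -/
def InverseMonoid.liftBy {S : Type u} {T : Type v} [InverseMonoid S] [InverseMonoid T]
    (R : Set (S × S)) (f : InverseMonoidHom S T)
    (hf : ∀ p ∈ R, f.toMonoidHom p.1 = f.toMonoidHom p.2) :
    InverseMonoidHom (InverseMonoid.QuotientBy R) T where
  toMonoidHom := (InverseMonoid.cong R).lift f.toMonoidHom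
    fun _ _ h => InverseMonoid.CongGen.map_eq f hf h
  map_inv' := by rintro ⟨x⟩; exact f.map_inv' x

/-- The value of a term in an inverse monoid. -/
def ITerm.eval {X : Type u} {T : Type v} [InverseMonoid T] (f : X → T) : ITerm X → T
  | of x => f x
  | one => 1
  | mul a b => eval f a * eval f b
  | inv a => (eval f a)⁻¹

theorem ITerm.Rel.eval_eq {X : Type u} {T : Type v} [InverseMonoid T] (f : X → T)
    {a b : ITerm X} (h : ITerm.Rel a b) : a.eval f = b.eval f := by
  induction h with
  | refl => rfl
  | symm _ ih => exact ih.symm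
  | trans _ _ ih₁ ih₂ => exact ih₁.trans ih₂
  | mul_congr _ _ ih₁ ih₂ => simp only [eval, ih₁, ih₂]
  | inv_congr _ ih => simp only [eval, ih]
  | mul_assoc => exact _root_.mul_assoc _ _ _
  | one_mul => exact _root_.one_mul _
  | mul_one => exact _root_.mul_one _
  | inv_invol => exact InverseMonoid.inv_invol _
  | inv_anti => exact InverseMonoid.inv_anti _ _
  | mul_inv_mul_self => exact InverseMonoid.mul_inv_mul_self _
  | mul_inv_comm => exact InverseMonoid.mul_inv_comm _ _

/-- The homomorphism extending a map on the free generators. -/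
def FreeInverseMonoid.lift {X : Type u} {T : Type v} [InverseMonoid T] (f : X → T) :
    InverseMonoidHom (FreeInverseMonoid X) T where
  toFun := Quotient.lift (s := ITerm.setoid X) (ITerm.eval f) fun _ _ h => h.eval_eq f
  map_one' := rfl
  map_mul' := by rintro ⟨a⟩ ⟨b⟩; rfl
  map_inv' := by rintro ⟨a⟩; rfl

/-- Two homomorphisms from a free restriction monoid that agree on the generators are equal. -/
theorem FreeRestrictionMonoid.hom_ext {X : Type u} {T : Type v} [RestrictionMonoid T]
    {f g : RestrictionMonoidHom (FreeRestrictionMonoid X) T} (h : ∀ x, f (of x) = g (of x))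
    (a : FreeRestrictionMonoid X) : f a = g a := by
  obtain ⟨t⟩ := a
  change f (mk t) = g (mk t)
  induction t with
  | of x => exact h x
  | one => exact f.map_one'.trans g.map_one'.symm
  | mul a b iha ihb =>
    exact (f.map_mul (mk a) (mk b)).trans
      ((congrArg₂ (· * ·) iha ihb).trans (g.map_mul (mk a) (mk b)).symm)
  | rstar a ih =>
    exact (f.map_rstar (mk a)).trans
      ((congrArg RestrictionMonoid.rstar ih).trans (g.map_rstar (mk a)).symm)
  | rplus a ih =>
    exact (f.map_rplus (mk a)).trans
      ((congrArg RestrictionMonoid.rplus ih).trans (g.map_rplus (mk a)).symm)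

/-! ### The least group congruence of an inverse monoid -/

namespace InverseMonoid

open RestrictionMonoid

variable {S : Type u} [InverseMonoid S]

/-- This and the next lemma express conjugates of projections without inverses, so that they can be
lifted along `ψ_R`. -/
theorem mul_rplus_mul_inv (z w : S) : z * rplus w * z⁻¹ = rplus (z * w) := by
  change z * (w * w⁻¹) * z⁻¹ = z * w * (z * w)⁻¹
  simp only [inv_anti, mul_assoc]

theorem inv_mul_rplus_mul (z w : S) : z⁻¹ * rplus w * z = rstar (rplus w * z) := by
  change z⁻¹ * (w * w⁻¹) * z = (w * w⁻¹ * z)⁻¹ * (w * w⁻¹ * z)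
  have h : (w * w⁻¹) * (w * w⁻¹) = w * w⁻¹ := by rw [← mul_assoc, mul_inv_mul_self]
  rw [inv_anti, inv_anti w, inv_invol, mul_assoc z⁻¹ (w * w⁻¹), mul_assoc z⁻¹,
    ← mul_assoc (w * w⁻¹) (w * w⁻¹), h]

variable (S) in
/-- The least group congruence: `a` and `b` are related if `ea = eb` for some idempotent `e`. -/
def groupCon : Con S where
  r a b := ∃ z : S, rplus z * a = rplus z * b
  iseqv :=
    ⟨fun a => ⟨1, rfl⟩, fun ⟨z, h⟩ => ⟨z, h.symm⟩, fun {a b c} ⟨z, h⟩ ⟨w, h'⟩ => ⟨rplus z * w, by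
      rw [rplus_rplus_mul]
      calc rplus z * rplus w * a = rplus w * (rplus z * a) := by rw [rplus_comm, mul_assoc]
        _ = rplus z * (rplus w * b) := by rw [h, ← mul_assoc, rplus_comm, mul_assoc]
        _ = rplus z * rplus w * c := by rw [h', mul_assoc]⟩⟩
  mul' := fun {a b c d} ⟨z, h⟩ ⟨w, h'⟩ => by
    have key : rplus z * (rplus (a * w) * (a * c)) = rplus z * (rplus (b * w) * (b * d)) := by
      rw [← mul_assoc (rplus (a * w)), ← mul_rplus, ← mul_assoc (rplus (b * w)), ← mul_rplus,
        mul_assoc a, h', ← mul_assoc, h]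
      simp only [mul_assoc]
    have key' : rplus z * rplus (a * w) = rplus z * rplus (b * w) := by
      rw [← rplus_rplus_mul, ← rplus_rplus_mul, ← mul_assoc, ← mul_assoc, h]
    -- The naive projection `z^+w^+` does not suffice, since `w^+` must first be moved past `a`,
    -- where it becomes `(aw)^+`. By `key'`, using `b` in place of `a` gives the same projection.
    refine ⟨rplus z * (a * w), ?_⟩
    rw [rplus_rplus_mul, mul_assoc, key, ← mul_assoc, key', ← mul_assoc]

variable (S) in
/-- The greatest group image of an inverse monoid. -/
def GroupImage : Type u := (groupCon S).Quotient

instance : Monoid (GroupImage S) := inferInstanceAs (Monoid (groupCon S).Quotient)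

theorem groupCon_inv {a b : S} (h : groupCon S a b) : groupCon S a⁻¹ b⁻¹ := by
  obtain ⟨z, h⟩ := h
  have h' : a⁻¹ * rplus z = b⁻¹ * rplus z := by
    have := congrArg (·⁻¹) h
    have hz : (rplus z)⁻¹ = rplus z := by
      change (z * z⁻¹)⁻¹ = z * z⁻¹
      rw [inv_anti, inv_invol]
    simpa only [inv_anti, hz] using this
  -- Inverting turns the left factor `z^+` into a right factor; moving it back across `a⁻¹` produces
  -- `(a⁻¹z)^+`, which equals `(b⁻¹z)^+` by `h'`.
  refine ⟨a⁻¹ * z, ?_⟩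
  rw [← mul_rplus, h', mul_rplus, ← rplus_mul_rplus a⁻¹, h', rplus_mul_rplus]

instance : Group (GroupImage S) where
  inv := Quotient.map (sa := (groupCon S).toSetoid) (sb := (groupCon S).toSetoid)
    (fun x => x⁻¹) fun _ _ h => groupCon_inv h
  inv_mul_cancel := by
    rintro ⟨x⟩
    refine Quotient.sound (s := (groupCon S).toSetoid) ⟨x⁻¹, ?_⟩
    change x⁻¹ * x⁻¹⁻¹ * (x⁻¹ * x) = x⁻¹ * x⁻¹⁻¹ * 1
    rw [inv_invol, mul_one, mul_assoc, mul_inv_mul_self']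

/-- The projection to the greatest group image. -/
def toGroupImage : S →* GroupImage S := (groupCon S).mk'

theorem toGroupImage_eq_iff {a b : S} :
    toGroupImage a = toGroupImage b ↔ ∃ z : S, rplus z * a = rplus z * b :=
  (groupCon S).eq

end InverseMonoid

/-! ### Free restriction and inverse monoids over a monoid -/

namespace MonoidExpansion

open RestrictionMonoid

variable {M : Type u} [Monoid M]
  {R : Set (FreeRestrictionMonoid M × FreeRestrictionMonoid M)}

/-- The homomorphism from `FI_R(M)` to an inverse monoid `T` induced by a map `M → T` whose
extension to the free restriction monoid satisfies the relations `R`. -/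
def liftFI {T : Type v} [InverseMonoid T] (g : M → T)
    (hg : ∀ p ∈ R, FreeRestrictionMonoid.lift g p.1 = FreeRestrictionMonoid.lift g p.2) :
    RestrictionMonoidHom (FI R) T :=
  (InverseMonoid.liftBy (imageRelations R) (FreeInverseMonoid.lift g) (by
    have hfac : ∀ a, (FreeInverseMonoid.lift g).toRestrictionMonoidHom (toFreeInverse M a) =
        FreeRestrictionMonoid.lift g a :=
      FreeRestrictionMonoid.hom_ext
        (f := (FreeInverseMonoid.lift g).toRestrictionMonoidHom.comp (toFreeInverse M))
        fun _ => rfl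
    rintro _ ⟨p, hp, rfl⟩
    exact (hfac p.1).trans ((hg p hp).trans (hfac p.2).symm))).toRestrictionMonoidHom

/-- Two homomorphisms from `FR_R(M)` that agree on the generators are equal. -/
theorem FR_hom_ext {T : Type v} [RestrictionMonoid T] {f g : RestrictionMonoidHom (FR R) T}
    (h : ∀ m, f (iotaFR R m) = g (iotaFR R m)) (a : FR R) : f a = g a := by
  obtain ⟨a, rfl⟩ := mkBy_surjective R a
  let q : RestrictionMonoidHom (FreeRestrictionMonoid M) (FR R) :=
    { toMonoidHom := mkBy R, map_rstar' := mkBy_rstar R, map_rplus' := mkBy_rplus R }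
  exact FreeRestrictionMonoid.hom_ext (f := f.comp q) (g := g.comp q) h a

/-- The Munn representation of a restriction monoid. -/
noncomputable def munnHom (S : Type u) [RestrictionMonoid S] :
    RestrictionMonoidHom S (Projection S ≃. Projection S) where
  toFun := munn
  map_one' := munn_one
  map_mul' := munn_mul
  map_rstar' := munn_rstar
  map_rplus' := munn_rplus

/-- `ψ_R` is injective on the projections. -/
theorem psi_injective_on_projections {e f : Projection (FR R)} (h : psi R e.1 = psi R f.1) :
    e = f := by
  let g : M → (Projection (FR R) ≃. Projection (FR R)) := fun m => munn (iotaFR R m)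
  let q : RestrictionMonoidHom (FreeRestrictionMonoid M) (FR R) :=
    { toMonoidHom := mkBy R, map_rstar' := mkBy_rstar R, map_rplus' := mkBy_rplus R }
  have hq : ∀ a, FreeRestrictionMonoid.lift g a = munn (mkBy R a) :=
    FreeRestrictionMonoid.hom_ext (g := (munnHom (FR R)).comp q) fun _ => rfl
  have hg : ∀ p ∈ R, FreeRestrictionMonoid.lift g p.1 = FreeRestrictionMonoid.lift g p.2 := by
    intro p hp
    rw [hq, hq, (mkBy_eq_iff R).2 (.of hp)]
  -- The Munn representation factors through `ψ_R`, as both sides agree on generators.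
  have hfac : ∀ a, liftFI g hg (psi R a) = munn a :=
    FR_hom_ext (f := (liftFI g hg).comp (psi R)) (g := munnHom (FR R)) fun _ => rfl
  apply munn_injective_on_projections
  rw [← hfac, ← hfac, h]

theorem iotaFR_one (hR : IsAdmissible R) : iotaFR R (1 : M) = 1 :=
  (mkBy_eq_iff R).2 (hR.premorphism _ (Or.inl rfl))

theorem iotaFR_mul (hR : IsAdmissible R) (m n : M) :
    iotaFR R m * iotaFR R n = rplus (iotaFR R m * iotaFR R n) * iotaFR R (m * n) :=
  (mkBy_eq_iff R).2 (hR.premorphism _ (Or.inr ⟨(m, n), rfl⟩))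

/-- Since `a^+ = b^+c^+` and `c^+c = c`, any projection in front of `c` may be replaced by `a^+`. -/
theorem eq_rplus_mul_of_eq {S : Type u} [RestrictionMonoid S] {a b c : S}
    (h : a = rplus b * c) : a = rplus a * c := by
  conv_rhs => rw [h, rplus_rplus_mul, mul_assoc, rplus_mul_self, ← h]

/-- Every element `a` of `FR_R(M)` has the form `a^+ ⌊m⌋`. -/
theorem exists_eq_rplus_mul_iotaFR (hR : IsAdmissible R) (a : FR R) :
    ∃ m, a = rplus a * iotaFR R m := by
  obtain ⟨⟨t⟩, rfl⟩ := mkBy_surjective R a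
  change ∃ m, mkBy R (FreeRestrictionMonoid.mk t) =
    rplus (mkBy R (FreeRestrictionMonoid.mk t)) * iotaFR R m
  induction t with
  | of x => exact ⟨x, (rplus_mul_self (iotaFR R x)).symm⟩
  | one => exact ⟨1, by rw [iotaFR_one hR]; exact (rplus_mul_self (1 : FR R)).symm⟩
  | mul s t ihs iht =>
    obtain ⟨m, hm⟩ := ihs
    obtain ⟨n, hn⟩ := iht
    -- From `s = s^+⌊m⌋` and `t = t^+⌊n⌋`, moving `t^+` left past `⌊m⌋` gives `st =
    -- s^+(⌊m⌋t)^+⌊m⌋⌊n⌋`, and the premorphism relation contributes `(⌊m⌋⌊n⌋)^+`. The witness is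
    -- chosen so that its `^+` is the product of these three projections.
    refine ⟨m * n, eq_rplus_mul_of_eq
      (b := rplus (mkBy R (.mk s)) * (rplus (iotaFR R m * mkBy R (.mk t)) *
        (iotaFR R m * iotaFR R n))) ?_⟩
    change mkBy R (.mk s) * mkBy R (.mk t) = _
    rw [rplus_rplus_mul, rplus_rplus_mul, mul_assoc, mul_assoc, ← iotaFR_mul hR,
      ← mul_assoc (rplus (iotaFR R m * _)), ← mul_rplus, mul_assoc, ← hn, ← mul_assoc, ← hm]
  | rstar t _ =>
    refine ⟨1, ?_⟩
    rw [iotaFR_one hR, mul_one]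
    exact (rplus_rstar (mkBy R (.mk t))).symm
  | rplus t _ =>
    refine ⟨1, ?_⟩
    rw [iotaFR_one hR, mul_one]
    exact (rplus_rplus (mkBy R (.mk t))).symm

/-! ### From a group embedding to injectivity -/

/-- A homomorphism from `M` to a monoid satisfies every admissible set of relations. -/
theorem lift_eq_of_mem {T : Type v} [RestrictionMonoid T] (f : M →* T) (hR : IsAdmissible R) :
    ∀ p ∈ R, FreeRestrictionMonoid.lift f p.1 = FreeRestrictionMonoid.lift f p.2 := by
  intro p hp
  refine CongGen.map_eq _ ?_ (hR.homomorphism p hp)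
  rintro _ (rfl | ⟨⟨m, n⟩, rfl⟩)
  · exact f.map_one
  · exact (f.map_mul m n).symm

theorem psi_injective_of_embeds (hR : IsAdmissible R) {G : Type v} [Group G] (f : M →* G)
    (hf : Function.Injective f) : Function.Injective (psi R) := by
  let := InverseMonoid.ofGroup G
  have hg := lift_eq_of_mem (R := R) f hR
  -- All projections become `1` in a group, so only the factor `⌊m⌋` survives.
  have hpsi : ∀ (a : FR R) (m : M), a = rplus a * iotaFR R m → liftFI f hg (psi R a) = f m := by
    intro a m h
    rw [h, RestrictionMonoidHom.map_mul, RestrictionMonoidHom.map_mul,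
      RestrictionMonoidHom.map_rplus, RestrictionMonoidHom.map_rplus]
    exact (congrArg (· * f m) (mul_inv_cancel (liftFI f hg (psi R a)))).trans (one_mul (f m))
  intro a b hab
  obtain ⟨m, hm⟩ := exists_eq_rplus_mul_iotaFR hR a
  obtain ⟨n, hn⟩ := exists_eq_rplus_mul_iotaFR hR b
  have hmn : m = n := hf (by rw [← hpsi a m hm, ← hpsi b n hn, hab])
  have he : (⟨rplus a, rplus_rplus a⟩ : Projection (FR R)) = ⟨rplus b, rplus_rplus b⟩ := by
    apply psi_injective_on_projections
    simp only [RestrictionMonoidHom.map_rplus, hab]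
  rw [hm, hn, hmn, show rplus a = rplus b from Subtype.ext_iff.1 he]

/-! ### From injectivity to a group embedding -/

/-- Conjugates of images of projections under `ψ_R` are images of projections. -/
theorem exists_psi_rplus_eq_conj (z : FI R) (p : FR R) :
    (∃ q, psi R (rplus q) = z * psi R (rplus p) * z⁻¹) ∧
      ∃ q, psi R (rplus q) = z⁻¹ * psi R (rplus p) * z := by
  obtain ⟨⟨t⟩, rfl⟩ := InverseMonoid.mkBy_surjective _ z
  let ev : ITerm M → FI R := fun t =>
    InverseMonoid.mkBy (imageRelations R) (FreeInverseMonoid.mk t)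
  change (∃ q, psi R (rplus q) = ev t * _ * (ev t)⁻¹) ∧ ∃ q, psi R (rplus q) = (ev t)⁻¹ * _ * ev t
  -- Both conjugations are carried together because the case of an inverse interchanges them; `p`
  -- varies because a product conjugates twice.
  induction t generalizing p with
  | of m =>
    change (∃ q, psi R (rplus q) = psi R (iotaFR R m) * _ * (psi R (iotaFR R m))⁻¹) ∧
      ∃ q, psi R (rplus q) = (psi R (iotaFR R m))⁻¹ * _ * psi R (iotaFR R m)
    refine ⟨⟨iotaFR R m * p, ?_⟩, ⟨rstar (rplus p * iotaFR R m), ?_⟩⟩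
    · rw [RestrictionMonoidHom.map_rplus, RestrictionMonoidHom.map_rplus,
        InverseMonoid.mul_rplus_mul_inv, RestrictionMonoidHom.map_mul]
    · rw [rplus_rstar, RestrictionMonoidHom.map_rplus, InverseMonoid.inv_mul_rplus_mul,
        RestrictionMonoidHom.map_rstar, RestrictionMonoidHom.map_mul,
        RestrictionMonoidHom.map_rplus]
  | one =>
    have h : ev .one = 1 := rfl
    have h' : (1 : FI R)⁻¹ = 1 := by
      simpa only [one_mul, mul_one] using InverseMonoid.mul_inv_mul_self (1 : FI R)
    simp only [h, h', one_mul, mul_one]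
    exact ⟨⟨p, rfl⟩, ⟨p, rfl⟩⟩
  | mul s t ihs iht =>
    have h : ev (.mul s t) = ev s * ev t := rfl
    obtain ⟨q, hq⟩ := (iht p).1
    obtain ⟨q', hq'⟩ := (ihs p).2
    obtain ⟨r, hr⟩ := (ihs q).1
    obtain ⟨r', hr'⟩ := (iht q').2
    refine ⟨⟨r, ?_⟩, ⟨r', ?_⟩⟩
    · rw [hr, hq, h, InverseMonoid.inv_anti]
      simp only [mul_assoc]
    · rw [hr', hq', h, InverseMonoid.inv_anti]
      simp only [mul_assoc]
  | inv t ih =>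
    have h : ev (.inv t) = (ev t)⁻¹ := rfl
    rw [h, InverseMonoid.inv_invol]
    exact (ih p).symm

/-- The projection `z^+ = z1z⁻¹` is a conjugate of the projection `1`. So `FI_R(M)` has no
projections beyond those coming from `FR_R(M)`. -/
theorem exists_psi_rplus_eq (z : FI R) : ∃ q, psi R (rplus q) = rplus z := by
  obtain ⟨q, hq⟩ := (exists_psi_rplus_eq_conj z (1 : FR R)).1
  refine ⟨q, hq.trans ?_⟩
  rw [rplus_one, RestrictionMonoidHom.map_one, mul_one]
  rfl

theorem embeds_of_psi_injective (hR : IsAdmissible R) (h : Function.Injective (psi R)) :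
    ∃ (G : Type u) (_ : Group G) (f : M →* G), Function.Injective f := by
  let f : M →* InverseMonoid.GroupImage (FI R) :=
    { toFun := fun m => InverseMonoid.toGroupImage (iotaFI R m)
      map_one' := by
        rw [← psi_iotaFR, iotaFR_one hR, RestrictionMonoidHom.map_one, map_one]
      map_mul' := fun m n => by
        rw [← map_mul, eq_comm, InverseMonoid.toGroupImage_eq_iff]
        -- With this witness the required equality is the image under `ψ_R` of the premorphism
        -- relation.
        refine ⟨iotaFI R m * iotaFI R n, ?_⟩
        rw [rplus_mul_self]
        have := congrArg (psi R) (iotaFR_mul hR m n)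
        simpa only [RestrictionMonoidHom.map_mul, RestrictionMonoidHom.map_rplus, psi_iotaFR]
          using this }
  refine ⟨_, inferInstance, f, fun m n hmn => ?_⟩
  obtain ⟨z, hz⟩ := InverseMonoid.toGroupImage_eq_iff.1 hmn
  obtain ⟨q, hq⟩ := exists_psi_rplus_eq z
  have hqmn : rplus q * iotaFR R m = rplus q * iotaFR R n := h (by
    rw [RestrictionMonoidHom.map_mul, RestrictionMonoidHom.map_mul, hq]; exact hz)
  let := RestrictionMonoid.trivial M
  -- With `^*` and `^+` constantly `1` on `M`, the map `⌊m⌋ ↦ m` respects `R` and erases the factor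
  -- `q^+`.
  let σ := liftBy R (FreeRestrictionMonoid.lift (MonoidHom.id M))
    (lift_eq_of_mem (MonoidHom.id M) hR)
  have := congrArg σ hqmn
  rw [RestrictionMonoidHom.map_mul, RestrictionMonoidHom.map_mul, RestrictionMonoidHom.map_rplus]
    at this
  exact (one_mul m).symm.trans (this.trans (one_mul n))

end MonoidExpansion

/-- A monoid `M` embeds into a group if and only if `ψ_R : FR_R(M) → FI_R(M)` is injective. -/
theorem mainTheorem4 {M : Type u} [Monoid M]
    (R : Set (FreeRestrictionMonoid M × FreeRestrictionMonoid M))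
    (hR : MonoidExpansion.IsAdmissible R) :
    (∃ (G : Type u) (_ : Group G) (f : M →* G), Function.Injective f) ↔
      Function.Injective (MonoidExpansion.psi R) :=
  ⟨fun ⟨_, _, f, hf⟩ => MonoidExpansion.psi_injective_of_embeds hR f hf,
    MonoidExpansion.embeds_of_psi_injective hR⟩
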